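/- In the Congested Clique model, $n$ nodes $1,\dots,n$ communicate in synchronous rounds; in every round each node may send to each node an individual message of $O(\log n)$ bits, depending deterministically on what it knows at that time, and local computation is free. When $n\times n$ matrices $S,T$ over a semiring are multiplied, the input of node $v$ consists of row $v$ of $S$ and row $v$ of $T$, and its output has to be row $v$ of $P=S\cdot T$. As usual, semiring elements are assumed to fit into $O(\log n)$ bits: for a constant $w$ there is a set $F$ of at most $2^{w(\lfloor\log_2 n\rfloor+1)}$ elements of the semiring, known to the nodes, that contains all entries of $S$ and $T$ and all partial sums $\sum_{\ell\in L}S[i][\ell]\,T[\ell][j]$, $L\subseteq\{1,\dots,n\}$ (for example, $F$ is the whole semiring if that has at most $n^{O(1)}$ elements). Let $nz(A)$ be the number of non-zero entries of a matrix $A$. A pair of integers $(a,b)$ is $n$-split if $a,b\in\{1,\dots,n\}$, both divide $n$, and $n/(ab)\ge 1$. For such a pair let $S_i$ ($1\le i\le a$) consist of the rows $(i-1)n/a+1,\dots,i\,n/a$ of $S$, and let $T_j$ ($1\le j\le b$) consist of the columns $(j-1)n/b+1,\dots,j\,n/b$ of $T$. The matrices $S,T$ are a sparsity-balanced pair with respect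 to $(a,b)$ if $nz(S_i)\le nz(S)/a+n$ for every $i$ and $nz(T_j)\le nz(T)/b+n$ for every $j$. **Theorem (SBMM).** For every $n$-split pair $(a,b)$ and every semiring $R$ (with $F\subseteq R$ as above) there is a deterministic Congested Clique algorithm SBMM on $n$ nodes that, for all $n\times n$ matrices $S,T$ over $R$ that form a sparsity-balanced pair with respect to $(a,b)$ (and whose entries and partial sums lie in $F$), computes the product $P=S\cdot T$ and completes in $$O\!\left(\frac{nz(S)\cdot b}{n^2}+\frac{nz(T)\cdot a}{n^2}+\frac{n}{ab}+1\right)$$ rounds. The constants in the message length and in the number of rounds depend only on $w$, not on $n,a,b,R,F,S,T$; the algorithm does not depend on $S$ and $T$, and in particular is not given $nz(S)$ and $nz(T)$. -/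

import Mathlib

universe u

/-- The length of a machine word for `n` nodes: `⌊log₂ n⌋ + 1` bits, which is `Θ(log n)`. -/
def wordLength (n : ℕ) : ℕ := Nat.log 2 n + 1

/-- A deterministic algorithm for the Congested Clique with node set `Fin n` in which every message
consists of `B` bits. Node `v` starts in a state that depends on `v` and on its own input only. In
every round it sends one (individual) message to each node, determined by its current state, and
then moves to a new state determined by its current state and the messages it received, where
`msgs u` is the message from node `u`. A node signals that it has finished by an output different
from `none`. Local computation is not charged for, as usual in this model. -/
structure CliqueAlgorithm (n B : ℕ) (In Out : Type u) where
  State : Type u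
  init : Fin n → In → State
  send : Fin n → State → Fin n → (Fin B → Bool)
  receive : Fin n → State → (Fin n → (Fin B → Bool)) → State
  output : Fin n → State → Option Out

namespace CliqueAlgorithm

variable {n B : ℕ} {In Out : Type u}

/-- The state of each node after `t` rounds, if node `v` has the input `x v`. -/
def stateAfter (A : CliqueAlgorithm n B In Out) (x : Fin n → In) : ℕ → Fin n → A.State
  | 0 => fun v => A.init v (x v)
  | t + 1 => fun v =>
      A.receive v (A.stateAfter x t v) (fun u => A.send u (A.stateAfter x t u) v)

/-- On the input `x` the algorithm completes in exactly `t` rounds, node `v` with the output `y v`: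
no node produces an output earlier, and after round `t` each node produces the required one. -/
def CompletesIn (A : CliqueAlgorithm n B In Out) (x : Fin n → In) (y : Fin n → Out) (t : ℕ) :
    Prop :=
  ∀ v, A.output v (A.stateAfter x t v) = some (y v) ∧
    ∀ s < t, A.output v (A.stateAfter x s v) = none

end CliqueAlgorithm

/-- The number of non-zero entries of a matrix. -/
noncomputable def nz {m k R : Type*} [Zero R] (A : Matrix m k R) : ℕ :=
  Set.ncard {p : m × k | A p.1 p.2 ≠ 0}

/-- `(a, b)` is an `n`-split pair: `a, b ∈ {1, …, n}`, both divide `n`, and `n / (a b) ≥ 1`. -/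
def IsSplitPair (n a b : ℕ) : Prop :=
  a ∈ Set.Icc 1 n ∧ b ∈ Set.Icc 1 n ∧ a ∣ n ∧ b ∣ n ∧ 1 ≤ (n : ℝ) / (a * b)

/-- The `i`-th of the `a` bands of `n / a` consecutive rows of `S` (counting from `0`). -/
def rowBand {n : ℕ} {R : Type*} (S : Matrix (Fin n) (Fin n) R) (a i : ℕ) :
    Matrix {r : Fin n // i * (n / a) ≤ r.val ∧ r.val < (i + 1) * (n / a)} (Fin n) R :=
  S.submatrix Subtype.val id

/-- The `j`-th of the `b` bands of `n / b` consecutive columns of `T` (counting from `0`). -/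
def colBand {n : ℕ} {R : Type*} (T : Matrix (Fin n) (Fin n) R) (b j : ℕ) :
    Matrix (Fin n) {c : Fin n // j * (n / b) ≤ c.val ∧ c.val < (j + 1) * (n / b)} R :=
  T.submatrix id Subtype.val

/-- `S` and `T` are a sparsity-balanced pair of matrices with respect to `(a, b)`. -/
def IsSparsityBalanced {n : ℕ} {R : Type*} [Zero R] (S T : Matrix (Fin n) (Fin n) R) (a b : ℕ) :
    Prop :=
  (∀ i < a, (nz (rowBand S a i) : ℝ) ≤ (nz S : ℝ) / a + n) ∧
    (∀ j < b, (nz (colBand T b j) : ℝ) ≤ (nz T : ℝ) / b + n)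

/-- The set `F` of semiring elements suffices to multiply `S` and `T`: it contains their entries and
all partial sums of the sums `∑ l, S i l * T l j` that define the entries of the product. -/
def Accommodates {n : ℕ} {R : Type*} [Semiring R] (F : Finset R) (S T : Matrix (Fin n) (Fin n) R) :
    Prop :=
  (∀ i j, S i j ∈ F) ∧ (∀ i j, T i j ∈ F) ∧
    ∀ (i j : Fin n) (L : Finset (Fin n)), ∑ l ∈ L, S i l * T l j ∈ F

/-! Put c = ⌊n/(ab)⌋. Each pair (S_i, T_j) is assigned to a group of c nodes, which compute the n/a
× n/b block S_i T_j. Within a group the summation index is cut into c consecutive intervals carrying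
about equal numbers of non-zero entries of S_i and T_j. By sparsity balance, a node needs O((nz(S)/a
+ nz(T)/b + n)/c + n) entries, which is O(n) times the claimed number of rounds.

Sparsity balance does not bound single rows, so an input owner could become a bottleneck. Hence the
entries are first redistributed in constantly many rounds: entries are numbered band by band, and
`holder` places them so that any n consecutive numbers of a band meet each node O(1) times
(`Learns.spread`). An interval of indices is a range of numbers, so every holder has only O(L/n + 1)
of the L entries that a node wants (`Learns.gather`). The partial sums then go to collectors spread
evenly over all nodes, which add them and deliver the rows.

Algorithms are handled through knowledge: `Learns` records which inputs a node may still confuse.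
Whatever is constant on the inputs that a node cannot tell apart may be sent or output by it, so
only distinguishability and message counts need checking. -/

namespace CliqueAlgorithm

/-! ### Sequential composition of algorithms -/

variable {n B : ℕ} {α β γ : Type u}

/-- The state in which the second algorithm starts, once the first has produced an output. -/
def handOver (A : CliqueAlgorithm n B α β) (A' : CliqueAlgorithm n B β γ) (v : Fin n)
    (s : A.State) : A.State ⊕ A'.State :=
  (A.output v s).elim (Sum.inl s) fun y => Sum.inr (A'.init v y)

/-- Run `A`, then run `A'` on the outputs of `A`. -/
def comp (A : CliqueAlgorithm n B α β) (A' : CliqueAlgorithm n B β γ) :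
    CliqueAlgorithm n B α γ where
  State := A.State ⊕ A'.State
  init v x := A.handOver A' v (A.init v x)
  send v s w := s.elim (fun s => A.send v s w) fun s => A'.send v s w
  receive v s msgs := s.elim (fun s => A.handOver A' v (A.receive v s msgs))
    fun s => Sum.inr (A'.receive v s msgs)
  output v s := s.elim (fun _ => none) (A'.output v)

section comp

variable {A : CliqueAlgorithm n B α β} {A' : CliqueAlgorithm n B β γ} {x : Fin n → α}
  {y : Fin n → β} {z : Fin n → γ} {t t' : ℕ}

theorem stateAfter_comp_handOver (h : A.CompletesIn x y t) :
    ∀ s ≤ t, ∀ v, (A.comp A').stateAfter x s v = A.handOver A' v (A.stateAfter x s v)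
  | 0, _, _ => rfl
  | s + 1, hs, v => by
    have ih : ∀ w, (A.comp A').stateAfter x s w = Sum.inl (A.stateAfter x s w) := fun w => by
      rw [stateAfter_comp_handOver h s (by omega) w, handOver, (h w).2 s (by omega)]
      rfl
    simp only [stateAfter, ih]
    rfl

theorem stateAfter_comp_add (h : A.CompletesIn x y t) :
    ∀ s v, (A.comp A').stateAfter x (t + s) v = Sum.inr (A'.stateAfter y s v)
  | 0, v => by
    rw [add_zero, stateAfter_comp_handOver h t le_rfl, handOver, (h v).1]
    rfl
  | s + 1, v => by
    rw [← add_assoc]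
    simp only [stateAfter, stateAfter_comp_add h s]
    rfl

/-- All nodes produce their first output in the same round, so they switch to the second algorithm
together and no round is lost. -/
theorem CompletesIn.comp (h : A.CompletesIn x y t) (h' : A'.CompletesIn y z t') :
    (A.comp A').CompletesIn x z (t + t') := by
  refine fun v => ⟨?_, fun s hs => ?_⟩
  · rw [stateAfter_comp_add h]
    exact (h' v).1
  · obtain hst | hst := lt_or_ge s t
    · rw [stateAfter_comp_handOver h s hst.le, handOver, (h v).2 s hst]
      rfl
    · obtain ⟨r, rfl⟩ := Nat.exists_eq_add_of_le hst
      rw [stateAfter_comp_add h]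
      exact (h' v).2 r (by omega)

end comp

/-- Node `v`, which holds `c`, sends the messages `s v c w 0, …, s v c w (K v c - 1)` to node `w`,
one per round. -/
def exchange (s : Fin n → α → Fin n → ℕ → Fin B → Bool) (K : Fin n → α → ℕ) :
    CliqueAlgorithm n B α (α × (Fin n → ℕ → Fin B → Bool)) where
  State := α × ℕ × (Fin n → ℕ → Fin B → Bool)
  init _ c := (c, 0, fun _ _ _ => false)
  send v q w := s v q.1 w q.2.1
  receive _ q msgs := (q.1, q.2.1 + 1, fun u => Function.update (q.2.2 u) q.2.1 (msgs u))
  output v q := if q.2.1 = K v q.1 then some (q.1, q.2.2) else none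

theorem stateAfter_exchange (s : Fin n → α → Fin n → ℕ → Fin B → Bool) (K : Fin n → α → ℕ)
    (x : Fin n → α) : ∀ t v, (exchange s K).stateAfter x t v =
      (x v, t, fun u k => if k < t then s u (x u) v k else fun _ => false)
  | 0, v => by simp [stateAfter, exchange]
  | t + 1, v => by
    simp only [stateAfter, stateAfter_exchange s K x t]
    simp only [exchange, Prod.mk.injEq, true_and]
    ext u k : 2
    obtain rfl | hk := eq_or_ne k t
    · simp
    · rw [Function.update_of_ne hk]
      have : k < t + 1 ↔ k < t := by omega
      simp only [this]

theorem completesIn_exchange {s : Fin n → α → Fin n → ℕ → Fin B → Bool} {K : Fin n → α → ℕ}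
    {x : Fin n → α} {t : ℕ} (hK : ∀ v, K v (x v) = t) :
    (exchange s K).CompletesIn x
      (fun v => (x v, fun u k => if k < t then s u (x u) v k else fun _ => false)) t := by
  intro v
  simp only [stateAfter_exchange]
  constructor
  · simp [exchange, hK]
  · intro r hr
    simp [exchange, hK, hr.ne]

/-- The algorithm that outputs `f v (x v)` at node `v` without communication. -/
def ofFun (f : Fin n → α → β) : CliqueAlgorithm n B α β where
  State := α
  init _ c := c
  send _ _ _ _ := false
  receive _ c _ := c
  output v c := some (f v c)

theorem completesIn_ofFun (f : Fin n → α → β) (x : Fin n → α) :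
    (ofFun (B := B) f).CompletesIn x (fun v => f v (x v)) 0 :=
  fun _ => ⟨rfl, by simp⟩

end CliqueAlgorithm

/-! ### Knowledge of the nodes and communication primitives -/

/-- Some algorithm with messages of `B` bits completes in `t x` rounds on every global input `x`,
where node `v` starts with `inp x v`, and then node `v` can tell apart any two global inputs that
are not related by `E v`. -/
def Learns {n : ℕ} (B : ℕ) {In : Type u} {X : Type*} (inp : X → Fin n → In) (t : X → ℕ)
    (E : Fin n → X → X → Prop) : Prop :=
  ∃ (γ : Type u) (A : CliqueAlgorithm n B In γ) (y : X → Fin n → γ),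
    (∀ x, A.CompletesIn (inp x) (y x) (t x)) ∧ ∀ v x x', y x v = y x' v → E v x x'

theorem exists_factor {X γ δ : Type*} [Nonempty δ] (y : X → γ) (z : X → δ)
    (h : ∀ x x', y x = y x' → z x = z x') : ∃ g : γ → δ, ∀ x, g (y x) = z x := by
  classical
  refine ⟨Function.extend y z fun _ => Classical.arbitrary δ, fun x => ?_⟩
  exact Function.FactorsThrough.extend_apply (fun a b hab => h a b hab) _ x

theorem exists_injOn_bits {V : Type*} {B : ℕ} (G : Finset V) (hG : G.card ≤ 2 ^ B) :
    ∃ enc : V → Fin B → Bool, Set.InjOn enc G := by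
  classical
  obtain ⟨f⟩ : Nonempty (G ↪ (Fin B → Bool)) :=
    Function.Embedding.nonempty_of_card_le (by simpa using hG)
  refine ⟨fun v => if h : v ∈ G then f ⟨v, h⟩ else fun _ => false, fun v hv v' hv' h => ?_⟩
  have hv : v ∈ G := hv
  have hv' : v' ∈ G := hv'
  simpa [hv, hv'] using h

namespace Learns

variable {n B : ℕ} {In : Type u} {X : Type*} {inp : X → Fin n → In} {t : X → ℕ}
  {E E' : Fin n → X → X → Prop}

theorem start (inp : X → Fin n → In) :
    Learns B inp (fun _ => 0) fun v x x' => inp x v = inp x' v :=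
  ⟨In, .ofFun fun _ => id, inp, fun x => CliqueAlgorithm.completesIn_ofFun _ (inp x),
    fun _ _ _ h => h⟩

theorem mono (h : Learns B inp t E) (hE : ∀ v x x', E v x x' → E' v x x') :
    Learns B inp t E' := by
  obtain ⟨γ, A, y, hA, hy⟩ := h
  exact ⟨γ, A, y, hA, fun v x x' hv => hE v x x' (hy v x x' hv)⟩

/-- The messages of `u` factor through what `u` knows. The duration `K` must be known to every node,
since all have to stop simultaneously. -/
theorem sendBits (h : Learns B inp t E) (K : X → ℕ) (m : X → Fin n → Fin n → ℕ → Fin B → Bool)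
    (hK : ∀ v x x', E v x x' → K x = K x') (hm : ∀ u x x', E u x x' → m x u = m x' u) :
    Learns B inp (fun x => t x + K x)
      fun v x x' => E v x x' ∧ ∀ u, ∀ k < K x, m x u v k = m x' u v k := by
  obtain ⟨γ, A, y, hA, hy⟩ := h
  choose s hs using fun u => exists_factor (fun x => y x u) (fun x => m x u)
    fun x x' hx => hm u x x' (hy u x x' hx)
  choose k hk using fun u => exists_factor (fun x => y x u) K
    fun x x' hx => hK u x x' (hy u x x' hx)
  refine ⟨_, A.comp (.exchange s k), _, fun x => (hA x).comp <|
    CliqueAlgorithm.completesIn_exchange fun v => hk v x, fun v x x' hx => ?_⟩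
  rw [Prod.mk.injEq] at hx
  have hE := hy v x x' hx.1
  refine ⟨hE, fun u j hj => ?_⟩
  have h1 := congr_fun (congr_fun hx.2 u) j
  have hj' : j < K x' := hK v x x' hE ▸ hj
  simpa only [hj, hj', if_true, hs] using h1

/-- In one round, every node `u` sends a value `m x u v` to each node `v`. -/
theorem send (h : Learns B inp t E) {V : Type*} (G : Finset V) (hG : G.card ≤ 2 ^ B)
    (m : X → Fin n → Fin n → V) (hmG : ∀ x u v, m x u v ∈ G)
    (hm : ∀ u v x x', E u x x' → m x u v = m x' u v) :
    Learns B inp (fun x => t x + 1) fun v x x' => E v x x' ∧ ∀ u, m x u v = m x' u v := by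
  obtain ⟨enc, henc⟩ := exists_injOn_bits G hG
  refine (h.sendBits (fun _ => 1) (fun x u v _ => enc (m x u v)) (fun _ _ _ _ => rfl)
    fun u x x' hx => ?_).mono fun v x x' hx => ⟨hx.1, fun u => ?_⟩
  · ext v : 1
    rw [hm u v x x' hx]
  · exact henc (hmG x u v) (hmG x' u v) (hx.2 u 0 one_pos)

/-- In `K x` rounds, every node `u` sends to each node `v` a partial function `m x u v` that has at
most `K x` values. -/
theorem sendPartial (h : Learns B inp t E) {ι V : Type*} [Fintype ι] (G : Finset V)
    (hG : Fintype.card ι * G.card + 1 ≤ 2 ^ B) (K : X → ℕ)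
    (hK : ∀ v x x', E v x x' → K x = K x') (m : X → Fin n → Fin n → ι → Option V)
    (hmG : ∀ x u v q, ∀ c ∈ m x u v q, c ∈ G)
    (hmK : ∀ x u v, (Finset.univ.filter fun q => (m x u v q).isSome).card ≤ K x)
    (hm : ∀ u v q x x', E u x x' → m x u v q = m x' u v q) :
    Learns B inp (fun x => t x + K x)
      fun v x x' => E v x x' ∧ ∀ u q, m x u v q = m x' u v q := by
  classical
  obtain ⟨enc, henc⟩ := exists_injOn_bits (B := B) (Finset.insertNone (Finset.univ (α := ι) ×ˢ G))
    (by simpa using hG)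
  -- Each value travels with its argument, so the order of the list is irrelevant to the receiver;
  -- past the end of the list `none` is sent as padding.
  let l (f : ι → Option V) : List ι := (Finset.univ.filter fun q => (f q).isSome).toList
  let item (f : ι → Option V) (k : ℕ) : Option (ι × V) :=
    (l f)[k]?.bind fun q => (f q).map fun c => (q, c)
  have mem_item (f : ι → Option V) (q : ι) (c : V) :
      f q = some c ↔ ∃ k < (l f).length, item f k = some (q, c) := by
    constructor
    · intro hq
      have : q ∈ l f := by simp [l, hq]
      obtain ⟨k, hk, rfl⟩ := List.mem_iff_getElem.1 this
      exact ⟨k, hk, by simp [item, hk, hq]⟩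
    · rintro ⟨k, hk, hq⟩
      simp only [item, List.getElem?_eq_getElem hk, Option.bind_some, Option.map_eq_some_iff,
        Prod.mk.injEq] at hq
      obtain ⟨_, h1, h2, rfl⟩ := hq
      rwa [h2] at h1
  have hlen x u v : (l (m x u v)).length ≤ K x := by simpa [l] using hmK x u v
  have hitem x u v k : item (m x u v) k ∈ Finset.insertNone (Finset.univ (α := ι) ×ˢ G) := by
    rw [Finset.mem_insertNone]
    intro p hp
    obtain ⟨q, -, hq⟩ := Option.bind_eq_some_iff.1 hp
    obtain ⟨c, hc, rfl⟩ := Option.map_eq_some_iff.1 hq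
    simpa using hmG x u v q c hc
  refine (h.sendBits K (fun x u v k => enc (item (m x u v) k)) hK
    fun u x x' hx => ?_).mono fun v x x' hx => ⟨hx.1, fun u q => ?_⟩
  · ext v k : 2
    rw [show m x u v = m x' u v from funext fun q => hm u v q x x' hx]
  · have hKx := hK v x x' hx.1
    have heq k (hk : k < K x) : item (m x u v) k = item (m x' u v) k :=
      henc (hitem x u v k) (hitem x' u v k) (hx.2 u k hk)
    have key : ∀ c, m x u v q = some c ↔ m x' u v q = some c := by
      intro c
      constructor
      · intro hc
        obtain ⟨k, hk, hk'⟩ := (mem_item _ _ _).1 hc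
        rw [heq k (hk.trans_le (hlen x u v))] at hk'
        refine (mem_item _ _ _).2 ⟨k, ?_, hk'⟩
        by_contra hlt
        simp [item, List.getElem?_eq_none (not_lt.1 hlt)] at hk'
      · intro hc
        obtain ⟨k, hk, hk'⟩ := (mem_item _ _ _).1 hc
        rw [← heq k (hKx ▸ hk.trans_le (hlen x' u v))] at hk'
        refine (mem_item _ _ _).2 ⟨k, ?_, hk'⟩
        by_contra hlt
        simp [item, List.getElem?_eq_none (not_lt.1 hlt)] at hk'
    exact Option.ext key

theorem exists_algorithm (h : Learns B inp t E) {Out : Type u} [Nonempty Out]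
    (out : X → Fin n → Out) (hout : ∀ v x x', E v x x' → out x v = out x' v) :
    ∃ A : CliqueAlgorithm n B In Out, ∀ x, A.CompletesIn (inp x) (out x) (t x) := by
  obtain ⟨γ, A, y, hA, hy⟩ := h
  choose g hg using fun v => exists_factor (fun x => y x v) (fun x => out x v)
    fun x x' hx => hout v x x' (hy v x x' hx)
  refine ⟨A.comp (.ofFun g), fun x => ?_⟩
  have := (hA x).comp (CliqueAlgorithm.completesIn_ofFun (B := B) g (y x))
  simpa only [hg, add_zero] using this

end Learns

/-! ### Counting in blocks and residue classes -/

section counting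

/-- The values of `φ` lie in a window of length `L`, which meets at most `L / n + 2` aligned blocks
of length `n`. -/
theorem Finset.card_le_div_add_two {ι : Type*} {n L : ℕ} (Ω : Finset ι) (φ : ι → ℕ)
    (hφ : ∀ p ∈ Ω, ∀ q ∈ Ω, φ q ≤ φ p + L)
    (hinj : ∀ p ∈ Ω, ∀ q ∈ Ω, φ p / n = φ q / n → p = q) : Ω.card ≤ L / n + 2 := by
  obtain rfl | hΩ := Ω.eq_empty_or_nonempty
  · simp
  obtain ⟨p, hp, hmin⟩ := Ω.exists_min_image φ hΩ
  have hcard : Ω.card ≤ (Finset.Icc (φ p / n) (φ p / n + L / n + 1)).card := by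
    refine Finset.card_le_card_of_injOn (fun q => φ q / n) (fun q hq => ?_)
      fun q hq r hr h => hinj q hq r hr h
    have h1 : φ p / n ≤ φ q / n := Nat.div_le_div_right (hmin q hq)
    have h2 : φ q / n ≤ (φ p + L) / n := Nat.div_le_div_right (hφ p hp q hq)
    have h3 : (φ p + L) / n ≤ φ p / n + L / n + 1 := by
      obtain rfl | hn := Nat.eq_zero_or_pos n
      · simp
      · rw [Nat.add_div hn]
        split_ifs <;> omega
    simp only [Finset.coe_Icc, Set.mem_Icc]
    omega
  rw [Nat.card_Icc] at hcard
  generalize φ p / n = x, L / n = y at hcard ⊢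
  omega

theorem Fin.card_filter_div_eq_le {n m : ℕ} (hm : 0 < m) (i : ℕ) :
    (Finset.univ.filter fun r : Fin n => r.val / m = i).card ≤ m := by
  have : (Finset.univ.filter fun r : Fin n => r.val / m = i).card ≤
      (Finset.range m).card := by
    refine Finset.card_le_card_of_injOn (fun r => r.val % m) (fun r _ => ?_)
      fun r hr s hs h => ?_
    · simpa using Nat.mod_lt _ hm
    · simp only [Finset.coe_filter, Finset.mem_univ, true_and, Set.mem_ofPred_eq] at hr hs
      have h1 := Nat.div_add_mod r.val m
      have h2 := Nat.div_add_mod s.val m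
      simp only at h
      rw [hr] at h1
      rw [hs] at h2
      exact Fin.ext (by omega)
  simpa using this

theorem Nat.add_mod_left_cancel_of_lt {n k c d : ℕ} (hc : c < n) (hd : d < n)
    (h : (k + c) % n = (k + d) % n) : c = d :=
  Nat.ModEq.eq_of_lt_of_lt (Nat.ModEq.add_left_cancel' k h) hc hd

theorem Finset.eq_filter_Ico_of_monotone {n : ℕ} {f : Fin n → ℕ} (hf : Monotone f) (k : ℕ) :
    ∃ lo ≤ n, ∃ hi ≤ n, (Finset.univ.filter fun l => f l = k) =
      Finset.univ.filter fun l : Fin n => lo ≤ l.val ∧ l.val < hi := by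
  obtain h | h := (Finset.univ.filter fun l => f l = k).eq_empty_or_nonempty
  · refine ⟨0, by omega, 0, by omega, ?_⟩
    rw [h]
    ext
    simp
  · refine ⟨_, (Finset.min' _ h).isLt.le, _, (Finset.max' _ h).isLt, ?_⟩
    ext l
    simp only [Finset.mem_filter, Finset.mem_univ, true_and]
    constructor
    · intro hl
      have hl' : l ∈ Finset.univ.filter fun l => f l = k := by simpa using hl
      exact ⟨Finset.min'_le _ _ hl', Nat.lt_succ_of_le (Finset.le_max' _ _ hl')⟩
    · rintro ⟨h1, h2⟩
      have h3 := (Finset.mem_filter.1 (Finset.min'_mem _ h)).2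
      have h4 := (Finset.mem_filter.1 (Finset.max'_mem _ h)).2
      have h5 := hf (show Finset.min' _ h ≤ l from h1)
      have h6 := hf (show l ≤ Finset.max' _ h from Nat.le_of_lt_succ h2)
      omega

end counting

/-! ### Balanced placement of indexed entries -/

section holder

/-- The node that stores the non-zero entry with index `e` of a band, where `n = a * m`. -/
def holder (n a m e : ℕ) : ℕ := (e / m + a * (e % m)) % n

variable {n a m e e' : ℕ}

/-- Inside an aligned block of `n = a * m` indices, `e / m` is a fixed multiple of `a` plus a digit
below `a`. That digit plus `a * (e % m)` is a two-digit expansion running through distinct numbers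
below `n`; the fixed multiple merely rotates them. -/
theorem holder_inj_of_div_eq (hn : n = a * m) (hm : 0 < m) (ha : 0 < a) (h : e / n = e' / n)
    (hh : holder n a m e = holder n a m e') : e = e' := by
  have hdiv : e / m / a = e' / m / a := by
    rw [Nat.div_div_eq_div_mul, Nat.div_div_eq_div_mul, mul_comm m a, ← hn, h]
  have hk := Nat.div_add_mod (e / m) a
  have hk' := Nat.div_add_mod (e' / m) a
  have h1 := Nat.mod_lt (e / m) ha
  have h2 := Nat.mod_lt (e' / m) ha
  have key : e / m % a + a * (e % m) = e' / m % a + a * (e' % m) := by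
    refine Nat.add_mod_left_cancel_of_lt (n := n) (k := a * (e / m / a)) ?_ ?_ ?_
    · have := Nat.mul_le_mul_left a (Nat.succ_le_of_lt (Nat.mod_lt e hm))
      rw [Nat.mul_succ] at this
      omega
    · have := Nat.mul_le_mul_left a (Nat.succ_le_of_lt (Nat.mod_lt e' hm))
      rw [Nat.mul_succ] at this
      omega
    · rw [← add_assoc, ← add_assoc, hk, hdiv, hk']
      exact hh
  have h3 : e / m % a = e' / m % a := by
    have := congrArg (· % a) key
    simpa [Nat.add_mul_mod_self_left] using this
  have h4 : e % m = e' % m := by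
    rw [h3] at key
    exact Nat.eq_of_mul_eq_mul_left ha (Nat.add_left_cancel key)
  rw [← Nat.div_add_mod e m, ← Nat.div_add_mod e' m, h4]
  congr 2
  rw [← hk, ← hk', hdiv, h3]

/-- With `e % m` fixed, the holder is `e / m < n` rotated by a constant. -/
theorem holder_inj_of_mod_eq (he : e < n * m) (he' : e' < n * m)
    (h : e % m = e' % m) (hh : holder n a m e = holder n a m e') : e = e' := by
  have hk : e / m < n := Nat.div_lt_of_lt_mul (by rwa [mul_comm])
  have hk' : e' / m < n := Nat.div_lt_of_lt_mul (by rwa [mul_comm])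
  unfold holder at hh
  rw [h, add_comm, add_comm (e' / m)] at hh
  have := Nat.add_mod_left_cancel_of_lt hk hk' hh
  rw [← Nat.div_add_mod e m, ← Nat.div_add_mod e' m, h, this]

end holder

/-! ### Numbering the non-zero entries of a band -/

section bands

open scoped Classical

variable {n m : ℕ} {R : Type*} [Zero R] (M : Matrix (Fin n) (Fin n) R)

/-- The number of non-zero entries of row `l` in the `i`-th band of `m` columns. -/
noncomputable def bandCount (m i : ℕ) (l : Fin n) : ℕ :=
  (Finset.univ.filter fun r : Fin n => r.val / m = i ∧ M l r ≠ 0).card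

/-- The number of non-zero entries of the first `l` rows in the `i`-th band of `m` columns. -/
noncomputable def bandStart (m i l : ℕ) : ℕ :=
  ∑ k ∈ Finset.univ.filter fun k : Fin n => k.val < l, bandCount M m i k

/-- The number of non-zero entries in the band of `m` columns of the entry `(l, r)` that precede it,
in the order of the rows. -/
noncomputable def bandIndex (m : ℕ) (l r : Fin n) : ℕ :=
  bandStart M m (r / m) l +
    (Finset.univ.filter fun s : Fin n => s < r ∧ s.val / m = r.val / m ∧ M l s ≠ 0).card

theorem bandCount_le (hm : 0 < m) (i : ℕ) (l : Fin n) : bandCount M m i l ≤ m :=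
  (Finset.card_le_card fun r hr => by simp_all).trans (Fin.card_filter_div_eq_le hm i)

theorem bandStart_le (hm : 0 < m) (i l : ℕ) : bandStart M m i l ≤ n * m :=
  calc bandStart M m i l
    _ ≤ (Finset.univ.filter fun k : Fin n => k.val < l).card * m :=
      Finset.sum_le_card_nsmul _ _ _ fun k _ => bandCount_le M hm i k
    _ ≤ n * m := Nat.mul_le_mul_right _ ((Finset.card_le_univ _).trans (by simp))

theorem bandStart_mono (i : ℕ) : Monotone (bandStart M m i) := fun k l hkl =>
  Finset.sum_le_sum_of_subset fun r hr => by
    simp only [Finset.mem_filter, Finset.mem_univ, true_and] at hr ⊢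
    omega

theorem bandStart_succ (i : ℕ) (l : Fin n) :
    bandStart M m i (l + 1) = bandStart M m i l + bandCount M m i l := by
  have : (Finset.univ.filter fun k : Fin n => k.val < l + 1) =
      insert l (Finset.univ.filter fun k : Fin n => k.val < l) := by
    ext k
    simp only [Finset.mem_filter, Finset.mem_univ, true_and, Finset.mem_insert, Fin.ext_iff]
    omega
  rw [bandStart, this, Finset.sum_insert (by simp), add_comm]
  rfl

theorem bandStart_le_bandIndex (l r : Fin n) :
    bandStart M m (r / m) l ≤ bandIndex M m l r := Nat.le_add_right _ _

variable {M}

theorem rank_lt_bandCount {l r : Fin n} (h : M l r ≠ 0) :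
    (Finset.univ.filter fun s : Fin n => s < r ∧ s.val / m = r.val / m ∧ M l s ≠ 0).card <
      bandCount M m (r / m) l := by
  refine Finset.card_lt_card (Finset.ssubset_iff_of_subset ?_ |>.2 ⟨r, by simp [h], by simp⟩)
  intro s hs
  simp_all

theorem bandIndex_lt_bandStart_succ {l r : Fin n} (h : M l r ≠ 0) :
    bandIndex M m l r < bandStart M m (r / m) (l + 1) := by
  rw [bandStart_succ]
  exact Nat.add_lt_add_left (rank_lt_bandCount h) _

theorem bandIndex_lt_bandStart_add (hm : 0 < m) {l r : Fin n} (h : M l r ≠ 0) :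
    bandIndex M m l r < bandStart M m (r / m) l + m :=
  Nat.add_lt_add_left ((rank_lt_bandCount h).trans_le (bandCount_le M hm _ l)) _

theorem bandIndex_lt (hm : 0 < m) {l r : Fin n} (h : M l r ≠ 0) : bandIndex M m l r < n * m :=
  (bandIndex_lt_bandStart_succ h).trans_le (bandStart_le M hm _ _)

/-- The rows of a band occupy disjoint ranges of indices, and within a row the index grows with the
column. -/
theorem bandIndex_inj {l l' r r' : Fin n} (h : M l r ≠ 0) (h' : M l' r' ≠ 0)
    (hr : r.val / m = r'.val / m) (he : bandIndex M m l r = bandIndex M m l' r') :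
    l = l' ∧ r = r' := by
  have row {l l' r r' : Fin n} (h : M l r ≠ 0) (hr : r.val / m = r'.val / m)
      (he : bandIndex M m l r = bandIndex M m l' r') : l' ≤ l := by
    by_contra! hlt
    have h1 := bandIndex_lt_bandStart_succ (m := m) h
    have h2 := bandStart_le_bandIndex (m := m) M l' r'
    have h3 := bandStart_mono M (m := m) (r / m) (Nat.succ_le_of_lt hlt)
    rw [← hr] at h2
    simp only [Nat.succ_eq_add_one] at h3
    omega
  obtain rfl : l = l' := le_antisymm (row h' hr.symm he.symm) (row h hr he)
  refine ⟨rfl, ?_⟩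
  have col {r r' : Fin n} (h : M l r ≠ 0) (hr : r.val / m = r'.val / m)
      (he : bandIndex M m l r = bandIndex M m l r') : r' ≤ r := by
    by_contra! hlt
    unfold bandIndex at he
    rw [hr, Nat.add_left_cancel_iff] at he
    refine he.not_lt (Finset.card_lt_card
      (Finset.ssubset_iff_of_subset ?_ |>.2 ⟨r, by simp [h, hr, hlt], by simp⟩))
    intro s hs
    simp only [Finset.mem_filter, Finset.mem_univ, true_and] at hs ⊢
    exact ⟨hs.1.trans hlt, hs.2⟩
  exact le_antisymm (col h' hr.symm he.symm) (col h hr he)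

variable (M)

theorem bandStart_eq_sum (i : ℕ) : bandStart M m i n = ∑ l, bandCount M m i l := by
  rw [bandStart, Finset.filter_true_of_mem fun k _ => k.isLt]

theorem nz_eq_sum {k k' : Type*} [Fintype k] [Fintype k'] (A : Matrix k k' R) :
    nz A = ∑ i, (Finset.univ.filter fun j => A i j ≠ 0).card := by
  rw [nz, Set.ncard_eq_toFinset_card', ← Finset.card_sigma]
  refine Finset.card_nbij' (fun p => ⟨p.1, p.2⟩) (fun p => (p.1, p.2)) ?_ ?_ ?_ ?_ <;>
    simp +contextual [Set.MapsTo, Set.LeftInvOn]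

theorem nz_transpose {k k' : Type*} (A : Matrix k k' R) : nz A.transpose = nz A :=
  Set.ncard_congr (fun p _ => p.swap) (fun _ h => h) (fun _ _ _ _ h => Prod.swap_injective h)
    fun p hp => ⟨p.swap, hp, p.swap_swap⟩

theorem div_eq_iff_band {m i r : ℕ} (hm : 0 < m) :
    r / m = i ↔ i * m ≤ r ∧ r < (i + 1) * m := by
  rw [Nat.div_eq_iff hm, Nat.le_sub_one_iff_lt (by positivity), add_one_mul]

theorem nz_colBand {b : ℕ} (hm : 0 < n / b) (j : ℕ) :
    nz (colBand M b j) = ∑ l, bandCount M (n / b) j l := by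
  rw [nz_eq_sum]
  refine Finset.sum_congr rfl fun l _ => ?_
  refine Finset.card_bij (fun r _ => r.val) ?_ ?_ ?_
  · rintro ⟨r, hr⟩ h
    exact Finset.mem_filter.2
      ⟨Finset.mem_univ _, (div_eq_iff_band hm).2 hr, (Finset.mem_filter.1 h).2⟩
  · intro r _ s _ h
    exact Subtype.ext h
  · intro r hr
    simp only [Finset.mem_filter, Finset.mem_univ, true_and, div_eq_iff_band hm] at hr
    exact ⟨⟨r, hr.1⟩, Finset.mem_filter.2 ⟨Finset.mem_univ _, hr.2⟩, rfl⟩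

end bands

/-! ### Redistributing and collecting entries -/

section spread

open scoped Classical

variable {n : ℕ} {R : Type*} [Zero R]

theorem bandIndex_congr {m : ℕ} {M M' : Matrix (Fin n) (Fin n) R} {l r : Fin n} (h : M l = M' l)
    (hs : bandStart M m (r / m) l = bandStart M' m (r / m) l) :
    bandIndex M m l r = bandIndex M' m l r := by
  unfold bandIndex
  rw [hs, h]

/-- The non-zero entries of `M` that are stored by node `u`. -/
noncomputable def held (M : Matrix (Fin n) (Fin n) R) (a m : ℕ) (u : Fin n)
    (q : Fin n × Fin n) : Option R :=
  if M q.1 q.2 ≠ 0 ∧ holder n a m (bandIndex M m q.1 q.2) = u then some (M q.1 q.2) else none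

/-- The non-zero entries of row `l` of `M`, with their indices, that node `l` sends to node `z` of
the zone of their band. -/
noncomputable def toZone (M : Matrix (Fin n) (Fin n) R) (m : ℕ) (l z : Fin n)
    (q : Fin n × Fin n) : Option (R × ℕ) :=
  if q.1 = l ∧ M l q.2 ≠ 0 ∧ q.2.val / m = z.val / m ∧ bandIndex M m l q.2 % m = z.val % m then
    some (M l q.2, bandIndex M m l q.2) else none

theorem toZone_eq_some {M : Matrix (Fin n) (Fin n) R} {m : ℕ} {l z : Fin n} {q : Fin n × Fin n}
    {c : R × ℕ} : toZone M m l z q = some c ↔ (q.1 = l ∧ M l q.2 ≠ 0 ∧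
      q.2.val / m = z.val / m ∧ bandIndex M m l q.2 % m = z.val % m) ∧
      (M l q.2, bandIndex M m l q.2) = c := by
  simp [toZone]

/-- The node `z` is the relay: the node of the band's zone, at offset equal to the index modulo `m`,
through which the entry passes on its way to its holder. -/
theorem held_eq_some {M : Matrix (Fin n) (Fin n) R} {a m : ℕ} (hn : n = a * m) (hm : 0 < m)
    {u : Fin n} {q : Fin n × Fin n} {c : R} : held M a m u q = some c ↔
      ∃ z e, ((toZone M m q.1 z q).filter fun c => holder n a m c.2 = u) = some (c, e) := by
  simp only [held, Option.ite_none_right_eq_some, Option.some.injEq, Option.filter_eq_some_iff,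
    toZone_eq_some, decide_eq_true_eq]
  constructor
  · rintro ⟨⟨h1, h2⟩, rfl⟩
    have hlt := Nat.mod_lt (bandIndex M m q.1 q.2) hm
    have hz : q.2.val / m * m + bandIndex M m q.1 q.2 % m < n := by
      have : q.2.val / m < a := Nat.div_lt_of_lt_mul (by rw [mul_comm, ← hn]; exact q.2.isLt)
      have := Nat.mul_le_mul_right m (Nat.succ_le_of_lt this)
      rw [Nat.succ_mul] at this
      omega
    refine ⟨⟨_, hz⟩, _, ⟨⟨trivial, h1, ?_, ?_⟩, rfl⟩, h2⟩
    · dsimp only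
      rw [Nat.mul_comm, Nat.mul_add_div hm, Nat.div_eq_of_lt hlt, add_zero]
    · dsimp only
      rw [Nat.mul_comm, Nat.mul_add_mod, Nat.mod_mod]
  · rintro ⟨z, e, ⟨⟨-, h1, -, -⟩, h2⟩, h3⟩
    rw [Prod.mk.injEq] at h2
    obtain ⟨rfl, rfl⟩ := h2
    exact ⟨⟨h1, h3⟩, rfl⟩

variable {B : ℕ} {In : Type u} {X : Type*} {inp : X → Fin n → In} {t : X → ℕ}
  {E : Fin n → X → X → Prop} {a m : ℕ}

/-- If node `l` knows row `l` of `M`, four rounds suffice to store the non-zero entries in a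
balanced way. -/
theorem Learns.spread (h : Learns B inp t E) (hn : n = a * m) (hm : 0 < m) (F : Finset R)
    (hB : n * n * (F.card * (n * n)) + 1 ≤ 2 ^ B) (hB' : n * n + 1 ≤ 2 ^ B)
    (M : X → Matrix (Fin n) (Fin n) R) (hF : ∀ x l r, M x l r ∈ F)
    (hM : ∀ l x x', E l x x' → M x l = M x' l) :
    Learns B inp (fun x => t x + 4)
      fun v x x' => E v x x' ∧ ∀ q, held (M x) a m v q = held (M x') a m v q := by
  have ha : 0 < n → 0 < a := fun h0 => Nat.pos_of_ne_zero (by rintro rfl; omega)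
  have hmn : 0 < n → m ≤ n := fun h0 => hn ▸ Nat.le_mul_of_pos_left m (ha h0)
  have hnm : 0 < n → n * m ≤ n * n := fun h0 => Nat.mul_le_mul_left n (hmn h0)
  -- Node `v` belongs to the zone of band `v / m`. It receives the row counts of that band and
  -- returns to each row the prefix sum, after which the owner of the row knows the indices of its
  -- entries.
  have h1 := h.send (Finset.range (n * n + 1)) (by simpa using hB')
    (fun x l v => bandCount (M x) m (v / m) l) (fun x l v => ?_) fun l v x x' hx => ?_
  have h2 := h1.send (Finset.range (n * n + 1)) (by simpa using hB')
    (fun x v l => bandStart (M x) m (v / m) l) (fun x v l => ?_) fun v l x x' hx => ?_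
  -- The owners send their entries to the relays, which pass them on to the holders.
  have h3 := h2.sendPartial (ι := Fin n × Fin n) (F ×ˢ Finset.range (n * n)) (by simpa using hB)
    (fun _ => 1) (fun _ _ _ _ => rfl) (fun x l z => toZone (M x) m l z)
    (fun x l z q c hc => ?_) (fun x l z => ?_) fun l z q x x' hx => ?_
  have h4 := h3.sendPartial (ι := Fin n × Fin n) (F ×ˢ Finset.range (n * n)) (by simpa using hB)
    (fun _ => 1) (fun _ _ _ _ => rfl)
    (fun x z u q => (toZone (M x) m q.1 z q).filter fun c => holder n a m c.2 = u)
    (fun x z u q c hc => ?_) (fun x z u => ?_) fun z u q x x' hx => ?_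
  · refine h4.mono fun v x x' hx => ⟨hx.1.1.1.1, fun q => ?_⟩
    refine Option.ext fun c => ?_
    rw [held_eq_some hn hm, held_eq_some hn hm]
    simp only [hx.2]
  · obtain ⟨hc, -⟩ := Option.filter_eq_some_iff.1 hc
    obtain ⟨⟨-, h0, -⟩, rfl⟩ := toZone_eq_some.1 hc
    have := bandIndex_lt hm h0
    have := hnm z.pos
    simp only [Finset.mem_product, hF, Finset.mem_range, true_and]
    omega
  -- Entries at one relay share band and residue, so a common holder would mean equal indices.
  · refine Finset.card_le_one.2 fun p hp q hq => ?_
    simp only [Finset.mem_filter, Finset.mem_univ, true_and, Option.isSome_iff_exists,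
      Option.filter_eq_some_iff, toZone_eq_some, decide_eq_true_eq] at hp hq
    obtain ⟨_, ⟨⟨hp2, hp3, hp4⟩, rfl⟩, hp5⟩ := hp
    obtain ⟨_, ⟨⟨hq2, hq3, hq4⟩, rfl⟩, hq5⟩ := hq
    have he := holder_inj_of_mod_eq (bandIndex_lt hm hp2) (bandIndex_lt hm hq2)
      (hp4.trans hq4.symm) (hp5.trans hq5.symm)
    have := bandIndex_inj hp2 hq2 (hp3.trans hq3.symm) he
    exact Prod.ext this.1 this.2
  · simp only [hx.2]
  · obtain ⟨⟨-, h0, -⟩, rfl⟩ := toZone_eq_some.1 hc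
    have := bandIndex_lt hm h0
    have := hnm l.pos
    simp only [Finset.mem_product, hF, Finset.mem_range, true_and]
    omega
  · refine Finset.card_le_one.2 fun p hp q hq => ?_
    simp only [Finset.mem_filter, Finset.mem_univ, true_and, Option.isSome_iff_exists,
      toZone_eq_some] at hp hq
    obtain ⟨-, ⟨hp1, hp2, hp3, hp4⟩, -⟩ := hp
    obtain ⟨-, ⟨hq1, hq2, hq3, hq4⟩, -⟩ := hq
    have hpq := hp3.trans hq3.symm
    have hrank (r : Fin n) (hr : M x l r ≠ 0) := (rank_lt_bandCount (m := m) hr).trans_le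
      (bandCount_le (M x) hm _ l)
    -- Within a row the indices of a band are consecutive and at most `m` in number, so their
    -- residues differ.
    have he : bandIndex (M x) m l p.2 = bandIndex (M x) m l q.2 := by
      have h5 := hp4.trans hq4.symm
      unfold bandIndex at h5 ⊢
      rw [hpq] at h5 ⊢
      rw [Nat.add_left_cancel_iff]
      refine Nat.ModEq.eq_of_lt_of_lt (Nat.ModEq.add_left_cancel' _ h5) ?_ (hrank _ hq2)
      rw [← hpq]
      exact hrank _ hp2
    exact Prod.ext (hp1.trans hq1.symm) (bandIndex_inj hp2 hq2 hpq he).2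
  · have hrow := hM l x x' hx.1.1
    simp only [toZone, hrow, bandIndex_congr hrow (hx.2 q.2)]
  · have := bandStart_le (M x) hm (v / m) l
    have := hnm v.pos
    rw [Finset.mem_range]
    omega
  · exact Finset.sum_congr rfl fun k _ => hx.2 k
  · have := bandCount_le (M x) hm (v / m) l
    have := hmn v.pos
    have := Nat.le_mul_self n
    rw [Finset.mem_range]
    omega
  · unfold bandCount
    rw [hM l x x' hx]

/-- If the non-zero entries of `M` are stored in a balanced way, and if everyone knows the set
`C x v` of rows and the band `i v` of columns that node `v` is interested in, where the entries of
that part of the band lie between indices that differ by at most `L`, then `L / n + 2` rounds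
suffice for all nodes to learn what they are interested in. -/
theorem Learns.gather (h : Learns B inp t E) (hn : n = a * m) (hm : 0 < m) (F : Finset R)
    (hB : n * n * F.card + 1 ≤ 2 ^ B)
    (M : X → Matrix (Fin n) (Fin n) R) (hF : ∀ x l r, M x l r ∈ F)
    (hM : ∀ u x x', E u x x' → ∀ q, held (M x) a m u q = held (M x') a m u q)
    (i : Fin n → ℕ) (C : X → Fin n → Finset (Fin n)) (hC : ∀ u v x x', E u x x' → C x v = C x' v)
    (L : X → ℕ) (hL : ∀ u x x', E u x x' → L x = L x')
    (hCL : ∀ x v, ∀ l ∈ C x v, ∀ k ∈ C x v,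
      bandStart (M x) m (i v) k + m ≤ bandStart (M x) m (i v) l + L x) :
    Learns B inp (fun x => t x + (L x / n + 2))
      fun v x x' => E v x x' ∧ ∀ l ∈ C x v, ∀ r : Fin n, r.val / m = i v → M x l r = M x' l r := by
  have hg := h.sendPartial (ι := Fin n × Fin n) F (by simpa using hB) (fun x => L x / n + 2)
    (fun u x x' hx => by rw [hL u x x' hx])
    (fun x u v q => if q.1 ∈ C x v ∧ q.2.val / m = i v then held (M x) a m u q else none)
    (fun x u v q c hc => ?_) (fun x u v => ?_) fun u v q x x' hx => ?_
  · refine hg.mono fun v x x' hx => ⟨hx.1, fun l hl r hr => ?_⟩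
    have hl' : l ∈ C x' v := hC v v x x' hx.1 ▸ hl
    -- Zeros are never sent: an entry reported by no node must be zero, and a non-zero one is
    -- reported by its holder.
    have key (u) : held (M x) a m u (l, r) = held (M x') a m u (l, r) := by
      simpa [hl, hr, hl'] using hx.2 u (l, r)
    have imp {x x' : X} (key : ∀ u, held (M x) a m u (l, r) = held (M x') a m u (l, r))
        (h0 : M x l r ≠ 0) : M x l r = M x' l r := by
      have hu : holder n a m (bandIndex (M x) m l r) < n := Nat.mod_lt _ l.pos
      have h2 := key ⟨_, hu⟩
      simp only [held, ne_eq, h0, not_false_eq_true, true_and, if_true] at h2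
      obtain ⟨-, h3⟩ := Option.ite_none_right_eq_some.1 h2.symm
      exact (Option.some.inj h3).symm
    by_cases h0 : M x l r = 0
    · by_cases h0' : M x' l r = 0
      · rw [h0, h0']
      · exact (imp (fun u => (key u).symm) h0').symm
    · exact imp key h0
  · obtain ⟨-, hc⟩ := Option.ite_none_right_eq_some.1 hc
    obtain ⟨-, rfl⟩ : _ ∧ M x q.1 q.2 = c := by simpa [held] using hc
    exact hF x _ _
  · have ha : 0 < a := Nat.pos_of_ne_zero (by rintro rfl; have := u.pos; omega)
    have mem {q : Fin n × Fin n} (hq : q ∈ Finset.univ.filter fun q : Fin n × Fin n =>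
        (if q.1 ∈ C x v ∧ q.2.val / m = i v then held (M x) a m u q else none).isSome = true) :
        (q.1 ∈ C x v ∧ q.2.val / m = i v) ∧ M x q.1 q.2 ≠ 0 ∧
          holder n a m (bandIndex (M x) m q.1 q.2) = u := by
      simpa [Option.isSome_iff_exists, held] using hq
    refine Finset.card_le_div_add_two _ (fun q => bandIndex (M x) m q.1 q.2)
      (fun p hp q hq => ?_) fun p hp q hq hpq => ?_
    · obtain ⟨⟨hp1, hp2⟩, hp3, -⟩ := mem hp
      obtain ⟨⟨hq1, hq2⟩, hq3, -⟩ := mem hq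
      have h1 := bandIndex_lt_bandStart_add hm hq3
      have h2 := bandStart_le_bandIndex (m := m) (M x) p.1 p.2
      have h3 := hCL x v p.1 hp1 q.1 hq1
      rw [hq2] at h1
      rw [hp2] at h2
      omega
    · obtain ⟨⟨hp1, hp2⟩, hp3, hp4⟩ := mem hp
      obtain ⟨⟨hq1, hq2⟩, hq3, hq4⟩ := mem hq
      have := bandIndex_inj hp3 hq3 (hp2.trans hq2.symm)
        (holder_inj_of_div_eq hn hm ha hpq (hp4.trans hq4.symm))
      exact Prod.ext this.1 this.2
  · simp only [hM u x x' hx q, hC u v x x' hx]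

end spread

/-! ### Sharing the work among the nodes -/

/-- After exchanging the sums, each `l` is counted by exactly one node, `p = (i * b + j) * c + κ l`.
-/
theorem Fin.sum_groups {n a b c i j : ℕ} {A : Type*} [AddCommMonoid A] (h : a * b * c ≤ n)
    (hi : i < a) (hj : j < b) (κ : Fin n → ℕ) (hκ : ∀ l, κ l < c) (f : Fin n → A) :
    ∑ p : Fin n, (if i = p.val / c / b ∧ j = p.val / c % b then
      ∑ l ∈ Finset.univ.filter fun l => κ l = p.val % c, f l else 0) = ∑ l, f l := by
  have h1 (p : Fin n) : (if i = p.val / c / b ∧ j = p.val / c % b then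
      ∑ l ∈ Finset.univ.filter fun l => κ l = p.val % c, f l else 0) =
      ∑ l, if (i = p.val / c / b ∧ j = p.val / c % b) ∧ κ l = p.val % c then f l else 0 := by
    split_ifs with hp
    · simp [hp, Finset.sum_filter]
    · simp [hp]
  simp only [h1]
  rw [Finset.sum_comm]
  refine Finset.sum_congr rfl fun l _ => ?_
  have hk := hκ l
  have hc : 0 < c := by omega
  have hb : 0 < b := by omega
  have hlt : (i * b + j) * c + κ l < n := by
    have h2 : i * b + j + 1 ≤ a * b := by
      have := Nat.mul_le_mul_right b (Nat.succ_le_of_lt hi)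
      rw [Nat.succ_mul] at this
      omega
    have := Nat.mul_le_mul_right c h2
    rw [Nat.succ_mul] at this
    omega
  have e1 : ((i * b + j) * c + κ l) / c = i * b + j := by
    rw [mul_comm, Nat.mul_add_div hc, Nat.div_eq_of_lt hk, add_zero]
  have e2 : ((i * b + j) * c + κ l) % c = κ l := by
    rw [mul_comm, Nat.mul_add_mod, Nat.mod_eq_of_lt hk]
  have e3 : (i * b + j) / b = i := by
    rw [mul_comm, Nat.mul_add_div hb, Nat.div_eq_of_lt hj, add_zero]
  have e4 : (i * b + j) % b = j := by
    rw [mul_comm, Nat.mul_add_mod, Nat.mod_eq_of_lt hj]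
  rw [Finset.sum_eq_single ⟨(i * b + j) * c + κ l, hlt⟩]
  · simp only [e1, e2, e3, e4, and_self, if_true]
  · rintro p - hp
    refine if_neg ?_
    rintro ⟨⟨h3, h4⟩, h5⟩
    refine hp (Fin.ext ?_)
    have h6 := Nat.div_add_mod p.val c
    have h7 := Nat.div_add_mod (p.val / c) b
    rw [← h3, ← h4] at h7
    rw [← h7, ← h5] at h6
    simp only
    rw [← h6]
    ring
  · simp

section jobs

open scoped Classical

variable {n : ℕ} {R : Type*} [Zero R]

theorem bandStart_le_of_balanced {a : ℕ} {M : Matrix (Fin n) (Fin n) R} (ha : 0 < a) (hn : a ∣ n)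
    (hM : ∀ j < a, (nz (colBand M a j) : ℝ) ≤ (nz M : ℝ) / a + n) (i : ℕ) :
    bandStart M (n / a) i n ≤ nz M / a + n := by
  obtain rfl | hn0 := Nat.eq_zero_or_pos n
  · simp [bandStart]
  have hm : 0 < n / a := Nat.div_pos (Nat.le_of_dvd hn0 hn) ha
  rw [bandStart_eq_sum]
  obtain hi | hi := lt_or_ge i a
  · have h1 := hM i hi
    rw [nz_colBand M hm i] at h1
    generalize (∑ l, bandCount M (n / a) i l) = s at h1 ⊢
    -- With `n` moved to the left, the real quotient may be replaced by its floor.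
    refine Nat.sub_le_iff_le_add.1 ((Nat.le_div_iff_mul_le ha).2 ?_)
    obtain hs | hs := le_total s n
    · simp [Nat.sub_eq_zero_of_le hs]
    · have ha' : (0 : ℝ) < a := by exact_mod_cast ha
      rw [← sub_le_iff_le_add, le_div_iff₀ ha'] at h1
      rw [← Nat.cast_le (α := ℝ)]
      push_cast [hs]
      exact h1
  -- Bands beyond the last are empty; they belong to the nodes `p ≥ a * b * c` left over by the
  -- grouping.
  · have : ∀ l, bandCount M (n / a) i l = 0 := fun l => by
      refine Finset.card_eq_zero.2 (Finset.filter_eq_empty_iff.2 ?_)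
      rintro r - ⟨hr, -⟩
      have h1 : r.val / (n / a) < a :=
        Nat.div_lt_of_lt_mul (by rw [Nat.div_mul_cancel hn]; exact r.isLt)
      omega
    simp [this]

/-- The number of non-zero entries of the first `l` columns of `S` and of the first `l` rows of `T`
in the `i`-th and `j`-th band, respectively. -/
noncomputable def load (S T : Matrix (Fin n) (Fin n) R) (a b i j l : ℕ) : ℕ :=
  bandStart S.transpose (n / a) i l + bandStart T (n / b) j l

/-- The part of the work of its group that the index `l` belongs to, if the work is shared among
`c` nodes. -/
noncomputable def part (S T : Matrix (Fin n) (Fin n) R) (a b c i j : ℕ) (l : Fin n) : ℕ :=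
  load S T a b i j l / (load S T a b i j n / c + 1)

/-- The indices for which node `p` is responsible. -/
noncomputable def job (S T : Matrix (Fin n) (Fin n) R) (a b c p : ℕ) : Finset (Fin n) :=
  Finset.univ.filter fun l => part S T a b c (p / c / b) (p / c % b) l = p % c

variable {S T : Matrix (Fin n) (Fin n) R} {a b c : ℕ}

theorem mem_job {p : ℕ} {l : Fin n} :
    l ∈ job S T a b c p ↔ part S T a b c (p / c / b) (p / c % b) l = p % c := by
  simp [job]

theorem load_mono (i j : ℕ) : Monotone (load S T a b i j) := fun _ _ h =>
  Nat.add_le_add (bandStart_mono _ i h) (bandStart_mono _ j h)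

theorem part_lt (hc : 0 < c) (i j : ℕ) (l : Fin n) : part S T a b c i j l < c := by
  refine Nat.div_lt_of_lt_mul ?_
  have h1 := load_mono (S := S) (T := T) (a := a) (b := b) i j l.isLt.le
  have h2 := Nat.lt_mul_div_succ (load S T a b i j n) hc
  rw [mul_comm]
  exact h1.trans_lt h2

/-- A job is thus described by two endpoints and fits into one message. -/
theorem job_eq_interval (p : ℕ) : ∃ lo ≤ n, ∃ hi ≤ n, job S T a b c p =
    Finset.univ.filter fun l : Fin n => lo ≤ l.val ∧ l.val < hi :=
  Finset.eq_filter_Ico_of_monotone (f := part S T a b c (p / c / b) (p / c % b))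
    (fun _ _ h => Nat.div_le_div_right (load_mono _ _ h)) (p % c)

theorem load_lt_of_mem_job {p : ℕ} {k l : Fin n} (hl : l ∈ job S T a b c p)
    (hk : k ∈ job S T a b c p) : load S T a b (p / c / b) (p / c % b) k <
      load S T a b (p / c / b) (p / c % b) l + (load S T a b (p / c / b) (p / c % b) n / c + 1) := by
  rw [mem_job, part] at hl hk
  generalize hV : load S T a b (p / c / b) (p / c % b) n / c + 1 = V at hl hk ⊢
  have hV0 : 0 < V := hV ▸ Nat.succ_pos _
  have h1 := Nat.div_mul_le_self (load S T a b (p / c / b) (p / c % b) l) V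
  have h2 := Nat.lt_mul_div_succ (load S T a b (p / c / b) (p / c % b) k) hV0
  rw [hk, Nat.mul_succ, mul_comm] at h2
  rw [hl] at h1
  omega

/-- A bound for the number of entries of `S` and of `T` that a node needs. -/
noncomputable def maxLoad (S T : Matrix (Fin n) (Fin n) R) (a b c : ℕ) : ℕ :=
  (nz S / a + nz T / b + 2 * n) / c + 1 + n

theorem load_le (ha : 0 < a) (han : a ∣ n) (hb : 0 < b) (hbn : b ∣ n)
    (h : IsSparsityBalanced S T a b) (i j : ℕ) :
    load S T a b i j n / c + 1 + n ≤ maxLoad S T a b c := by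
  have hS : ∀ i < a, (nz (colBand S.transpose a i) : ℝ) ≤ (nz S.transpose : ℝ) / a + n := by
    intro i hi
    -- A column band of the transpose is by definition a transposed row band.
    rw [nz_transpose, ← nz_transpose]
    exact h.1 i hi
  have h1 := bandStart_le_of_balanced ha han hS i
  have h2 := bandStart_le_of_balanced hb hbn h.2 j
  rw [nz_transpose] at h1
  unfold maxLoad
  gcongr
  unfold load
  omega

/-- Both summands of `load` are monotone, so each grows by no more than their sum. The final `n` in
`maxLoad` pays for the entries of the last index itself. -/
theorem bandStart_le_of_mem_job (ha : 0 < a) (han : a ∣ n) (hb : 0 < b) (hbn : b ∣ n)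
    (h : IsSparsityBalanced S T a b) {p : ℕ} {k l : Fin n} (hl : l ∈ job S T a b c p)
    (hk : k ∈ job S T a b c p) :
    bandStart S.transpose (n / a) (p / c / b) k + n / a ≤
      bandStart S.transpose (n / a) (p / c / b) l + maxLoad S T a b c ∧
    bandStart T (n / b) (p / c % b) k + n / b ≤
      bandStart T (n / b) (p / c % b) l + maxLoad S T a b c := by
  have h1 := load_le (c := c) ha han hb hbn h (p / c / b) (p / c % b)
  have h2 := load_lt_of_mem_job hl hk
  have h3 := Nat.div_le_self n a
  have h4 := Nat.div_le_self n b
  have hS := bandStart_mono S.transpose (m := n / a) (p / c / b)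
  have hT := bandStart_mono T (m := n / b) (p / c % b)
  generalize load S T a b (p / c / b) (p / c % b) n / c = V at h1 h2
  generalize maxLoad S T a b c = L at h1 ⊢
  unfold load at h2
  obtain hkl | hkl := le_total k l
  · have h5 := hS (show k.val ≤ l.val from hkl)
    have h6 := hT (show k.val ≤ l.val from hkl)
    omega
  · have h5 := hS (show l.val ≤ k.val from hkl)
    have h6 := hT (show l.val ≤ k.val from hkl)
    omega

end jobs

/-- The number `q.2 + q.1 * m'` determines the position inside the block and stays in a window of
length `m * m'`; its residue modulo `n` names the collector. -/
theorem card_band_product_le {n m m' : ℕ} (hm : 0 < m) (hm' : 0 < m') (i j h : ℕ) :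
    (Finset.univ.filter fun q : Fin n × Fin n => q.1.val / m = i ∧ q.2.val / m' = j ∧
      (q.2.val + q.1.val * m') % n = h).card ≤ m * m' / n + 2 := by
  refine Finset.card_le_div_add_two _ (fun q => q.2.val + q.1.val * m') (fun p hp q hq => ?_)
    fun p hp q hq hpq => ?_
  · simp only [Finset.mem_filter, Finset.mem_univ, true_and, div_eq_iff_band hm,
      div_eq_iff_band hm'] at hp hq
    have h1 := Nat.mul_le_mul_right m' hp.1.1
    have h2 := Nat.mul_le_mul_right m' (Nat.succ_le_of_lt hq.1.2)
    rw [Nat.succ_mul, add_mul, add_mul, one_mul] at h2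
    have h3 := hp.2.1.1
    have h4 := hq.2.1.2
    rw [add_mul, one_mul] at h4
    omega
  · simp only [Finset.mem_filter, Finset.mem_univ, true_and] at hp hq
    obtain ⟨-, hp2, hp3⟩ := hp
    obtain ⟨-, hq2, hq3⟩ := hq
    have he : p.2.val + p.1.val * m' = q.2.val + q.1.val * m' := by
      rw [← Nat.div_add_mod (p.2.val + _) n, ← Nat.div_add_mod (q.2.val + _) n, hpq, hp3, hq3]
    have h1 := congrArg (· % m') he
    simp only [Nat.add_mul_mod_self_right] at h1
    have h2 : p.2.val = q.2.val := by
      rw [← Nat.div_add_mod p.2.val m', ← Nat.div_add_mod q.2.val m', hp2, hq2, h1]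
    rw [h2, Nat.add_left_cancel_iff] at he
    exact Prod.ext (Fin.ext (Nat.eq_of_mul_eq_mul_right hm' he)) (Fin.ext h2)

/-! ### The algorithm -/

section algorithm

open scoped Classical

variable {n a b c B : ℕ} {R : Type u} [Semiring R]

/-- The contribution of node `p` to the entry `q` of the product, if node `h` collects it. -/
noncomputable def contribution (S T : Matrix (Fin n) (Fin n) R) (a b c : ℕ) (p h : Fin n)
    (q : Fin n × Fin n) : Option R :=
  if q.1.val / (n / a) = p.val / c / b ∧ q.2.val / (n / b) = p.val / c % b ∧
      (q.2.val + q.1.val * (n / b)) % n = h then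
    some (∑ l ∈ job S T a b c p, S q.1 l * T l q.2) else none

theorem mul_apply_eq_sum_contribution {S T : Matrix (Fin n) (Fin n) R} (han : a ∣ n)
    (hbn : b ∣ n) (hc : 0 < c) (habc : a * b * c ≤ n) {h r s : Fin n}
    (hrs : (s.val + r.val * (n / b)) % n = h) :
    (S * T) r s = ∑ p, (contribution S T a b c p h (r, s)).getD 0 := by
  rw [Matrix.mul_apply]
  have hi : r.val / (n / a) < a :=
    Nat.div_lt_of_lt_mul (by rw [Nat.div_mul_cancel han]; exact r.isLt)
  have hj : s.val / (n / b) < b :=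
    Nat.div_lt_of_lt_mul (by rw [Nat.div_mul_cancel hbn]; exact s.isLt)
  rw [← Fin.sum_groups habc hi hj (part S T a b c (r / (n / a)) (s / (n / b)))
    (part_lt hc _ _)]
  refine Finset.sum_congr rfl fun p _ => ?_
  by_cases hp : r.val / (n / a) = p.val / c / b ∧ s.val / (n / b) = p.val / c % b
  · rw [if_pos hp, contribution, if_pos ⟨hp.1, hp.2, hrs⟩, hp.1, hp.2]
    rfl
  · rw [if_neg hp, contribution, if_neg fun h => hp ⟨h.1, h.2.1⟩]
    rfl

/-- Sparsity-balanced matrix multiplication. -/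
theorem exists_sbmm (hn : 0 < n) (ha : 0 < a) (han : a ∣ n) (hb : 0 < b) (hbn : b ∣ n) (hc : 0 < c)
    (habc : a * b * c ≤ n) (F : Finset R) (hB : (n + 1) ^ 4 * (F.card + 1) ≤ 2 ^ B) :
    ∃ A : CliqueAlgorithm n B ((Fin n → R) × (Fin n → R)) (Fin n → R),
      ∀ S T : Matrix (Fin n) (Fin n) R, IsSparsityBalanced S T a b → Accommodates F S T →
        A.CompletesIn (fun v => (S v, T v)) (fun v => (S * T) v)
          (12 + 2 * (maxLoad S T a b c / n + 2) + (n / a * (n / b) / n + 2)) := by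
  -- Only admissible inputs count, so all bounds hold for every element of `X`.
  let X := {x : Matrix (Fin n) (Fin n) R × Matrix (Fin n) (Fin n) R //
    IsSparsityBalanced x.1 x.2 a b ∧ Accommodates F x.1 x.2}
  let S (x : X) := x.1.1
  let T (x : X) := x.1.2
  have hS (x r l) : S x r l ∈ F := x.2.2.1 r l
  have hT (x l s) : T x l s ∈ F := x.2.2.2.1 l s
  have hF (x r s L) : ∑ l ∈ L, S x r l * T x l s ∈ F := x.2.2.2.2 r s L
  have hnA : n = a * (n / a) := (Nat.mul_div_cancel' han).symm
  have hnB : n = b * (n / b) := (Nat.mul_div_cancel' hbn).symm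
  have hmA : 0 < n / a := Nat.div_pos (Nat.le_of_dvd hn han) ha
  have hmB : 0 < n / b := Nat.div_pos (Nat.le_of_dvd hn hbn) hb
  have hn2 : 1 ≤ n * n := Nat.mul_pos hn hn
  have hB1 : n * n * (F.card * (n * n)) + 1 ≤ 2 ^ B := by
    refine le_trans ?_ hB
    have h1 : n * n * (n * n) + 1 ≤ (n + 1) ^ 4 := by nlinarith
    nlinarith
  have hB2 : (n + 1) ^ 4 ≤ 2 ^ B := le_trans (Nat.le_mul_of_pos_right _ (by omega)) hB
  have hB3 : (n + 1) * (n + 1) ≤ 2 ^ B := le_trans (by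
    rw [← sq]
    exact Nat.pow_le_pow_right (by omega) (by omega)) hB2
  have hB4 : n * n + 1 ≤ 2 ^ B := by nlinarith
  have hB5 : n * n * F.card + 1 ≤ 2 ^ B := le_trans (by
    gcongr
    exact Nat.le_mul_of_pos_right _ hn2) hB1
  have hB6 : n * F.card + 1 ≤ 2 ^ B := le_trans (by
    gcongr
    exact Nat.le_mul_self n) hB5
  have hB7 : F.card ≤ 2 ^ B := by nlinarith
  let intervals : Finset (Finset (Fin n)) :=
    (Finset.range (n + 1) ×ˢ Finset.range (n + 1)).image fun p =>
      Finset.univ.filter fun l : Fin n => p.1 ≤ l.val ∧ l.val < p.2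
  have h0 := (Learns.start (B := B) fun (x : X) v => (S x v, T x v)).mono
    (E' := fun v x x' => S x v = S x' v ∧ T x v = T x' v) fun v x x' hx => by simpa using hx
  -- One round transposes `S`, so that node `l` holds column `l` of `S` besides row `l` of `T`.
  have h1 := (h0.send F hB7 (fun x r l => S x r l) hS fun r l x x' hx => by rw [hx.1]).mono
    (E' := fun v x x' => (S x).transpose v = (S x').transpose v ∧ T x v = T x' v)
    fun v x x' hx => ⟨funext hx.2, hx.1.2⟩
  have h2 := h1.spread hnA hmA F hB1 hB4 (fun x => (S x).transpose) (fun x l r => hS x r l)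
    fun l x x' hx => hx.1
  have h3 := h2.spread hnB hmB F hB1 hB4 T hT fun l x x' hx => hx.1.2
  -- The first pair lets `v` compute its job; the last two numbers give every node `nz S` and `nz
  -- T`, hence the common number of rounds for collecting.
  let count (x : X) (l : Fin n) (v : Fin n) : (ℕ × ℕ) × ℕ × ℕ :=
    ((bandCount (S x).transpose (n / a) (v / c / b) l, bandCount (T x) (n / b) (v / c % b) l),
      (Finset.univ.filter fun r => (S x).transpose l r ≠ 0).card,
      (Finset.univ.filter fun r => T x l r ≠ 0).card)
  have h4 := h3.send ((Finset.range (n + 1) ×ˢ Finset.range (n + 1)) ×ˢ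
    Finset.range (n + 1) ×ˢ Finset.range (n + 1))
    (by simpa only [Finset.card_product, Finset.card_range, show (n + 1) * (n + 1) *
      ((n + 1) * (n + 1)) = (n + 1) ^ 4 by ring] using hB2) count
    (fun x l v => by
      have hcard (Ω : Finset (Fin n)) : Ω.card < n + 1 :=
        Nat.lt_succ_of_le ((Finset.card_le_univ _).trans (by simp))
      simp only [count, bandCount, Finset.mem_product, Finset.mem_range, hcard, and_self])
    fun l v x x' hx => by simp only [count, bandCount, hx.1.1.1, hx.1.1.2]
  have hload (v x x') (hx : ∀ l, count x l v = count x' l v) (k) :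
      load (S x) (T x) a b (v / c / b) (v / c % b) k =
        load (S x') (T x') a b (v / c / b) (v / c % b) k := by
    simp only [count, Prod.mk.injEq] at hx
    simp only [load, bandStart, hx]
  have hjob (v x x') (hx : ∀ l, count x l v = count x' l v) :
      job (S x) (T x) a b c v = job (S x') (T x') a b c v := by
    ext l
    simp only [mem_job, part, hload v x x' hx]
  have hmax (v x x') (hx : ∀ l, count x l v = count x' l v) :
      maxLoad (S x) (T x) a b c = maxLoad (S x') (T x') a b c := by
    simp only [count, Prod.mk.injEq] at hx
    rw [maxLoad, maxLoad, ← nz_transpose (S x), ← nz_transpose (S x')]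
    simp only [nz_eq_sum, hx]
  -- Jobs are announced to all, so that holders know who needs which entries.
  have h5 := h4.send intervals (Finset.card_image_le.trans (by simpa using hB3))
    (fun x p _ => job (S x) (T x) a b c p)
    (fun x p _ => by
      obtain ⟨lo, hlo, hi, hhi, h⟩ := job_eq_interval (S := S x) (T := T x) (a := a) (b := b)
        (c := c) p
      refine Finset.mem_image.2 ⟨(lo, hi), ?_, h.symm⟩
      simp only [Finset.mem_product, Finset.mem_range]
      omega)
    fun p _ x x' hx => hjob p x x' hx.2
  have h6 := h5.gather hnA hmA F hB5 (fun x => (S x).transpose) (fun x l r => hS x r l)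
    (fun u x x' hx => hx.1.1.1.2) (fun v => v / c / b) (fun x v => job (S x) (T x) a b c v)
    (fun u v x x' hx => hx.2 v) (fun x => maxLoad (S x) (T x) a b c)
    (fun u x x' hx => hmax u x x' hx.1.2)
    fun x v l hl k hk => (bandStart_le_of_mem_job ha han hb hbn x.2.1 hl hk).1
  have h7 := h6.gather hnB hmB F hB5 T hT
    (fun u x x' hx => hx.1.1.1.2) (fun v => v / c % b) (fun x v => job (S x) (T x) a b c v)
    (fun u v x x' hx => hx.1.2 v) (fun x => maxLoad (S x) (T x) a b c)
    (fun u x x' hx => hmax u x x' hx.1.1.2)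
    fun x v l hl k hk => (bandStart_le_of_mem_job ha han hb hbn x.2.1 hl hk).2
  have h8 := h7.sendPartial (ι := Fin n × Fin n) F (by simpa using hB5)
    (fun _ => n / a * (n / b) / n + 2) (fun _ _ _ _ => rfl)
    (fun x => contribution (S x) (T x) a b c)
    (fun x p h q d hd => by
      obtain ⟨-, hd⟩ := Option.ite_none_right_eq_some.1 hd
      rw [← Option.some.inj hd]
      exact hF x _ _ _)
    (fun x p h => by
      simpa [contribution, Option.isSome_iff_exists] using card_band_product_le hmA hmB _ _ _)
    fun p h q x x' hx => by
      unfold contribution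
      refine ite_congr rfl (fun hq => ?_) fun _ => rfl
      rw [← hx.1.1.2 p]
      exact congrArg some (Finset.sum_congr rfl fun l hl => congrArg₂ (· * ·)
        (hx.1.2 l hl q.1 hq.1) (hx.2 l hl q.2 hq.2.1))
  -- For a fixed row, distinct columns have distinct collectors, so one round delivers the result.
  have h9 := h8.sendPartial (ι := Fin n) F (by simpa using hB6)
    (fun _ => 1) (fun _ _ _ _ => rfl)
    (fun x h r s => if (s.val + r.val * (n / b)) % n = h then some ((S x * T x) r s) else none)
    (fun x h r s d hd => by
      obtain ⟨-, hd⟩ := Option.ite_none_right_eq_some.1 hd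
      rw [← Option.some.inj hd, Matrix.mul_apply]
      exact hF x _ _ _)
    (fun x h r => by
      refine Finset.card_le_one.2 fun s hs s' hs' => ?_
      simp only [Finset.mem_filter, Finset.mem_univ, true_and, Option.isSome_ite] at hs hs'
      have := hs.trans hs'.symm
      rw [add_comm, add_comm s'.val] at this
      exact Fin.ext (Nat.add_mod_left_cancel_of_lt s.isLt s'.isLt this))
    fun h r s x x' hx => by
      refine ite_congr rfl (fun hq => ?_) fun _ => rfl
      rw [mul_apply_eq_sum_contribution han hbn hc habc hq,
        mul_apply_eq_sum_contribution han hbn hc habc hq]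
      simp only [hx.2]
  obtain ⟨A, hA⟩ := h9.exists_algorithm (fun x v => (S x * T x) v) fun r x x' hx => by
    ext s
    simpa using hx.2 ⟨(s.val + r.val * (n / b)) % n, Nat.mod_lt _ hn⟩ s
  refine ⟨A, fun S' T' hbal hacc => ?_⟩
  -- The 12 fixed rounds: transposing `S` (1), redistributing both matrices (4 + 4), counts (1),
  -- jobs (1), delivery (1).
  have := hA ⟨(S', T'), hbal, hacc⟩
  convert this using 1
  simp only [S, T]
  ring

end algorithm

/-! ### Bounding the number of rounds -/

/-- Rounding costs a factor of at most 2, as `n ≤ 2 * c * (a * b)` for `c = n / (a * b)`. The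
constant is 6 = 4 + 1 + 1: from `2 * n / c`, from the summand 1 and from the summand `n`, each
divided by `n`. -/
theorem maxLoad_div_le {n a b : ℕ} {R : Type*} [Zero R] (S T : Matrix (Fin n) (Fin n) R)
    (hn : 0 < n) (ha : 0 < a) (hb : 0 < b) (hab : a * b ≤ n) :
    ((maxLoad S T a b (n / (a * b)) / n : ℕ) : ℝ) ≤
      2 * ((nz S : ℝ) * b / (n : ℝ) ^ 2 + (nz T : ℝ) * a / (n : ℝ) ^ 2) + 6 := by
  have hn' : (1 : ℝ) ≤ n := by exact_mod_cast hn
  have ha' : (0 : ℝ) < a := by exact_mod_cast ha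
  have hb' : (0 : ℝ) < b := by exact_mod_cast hb
  have hab' : (a : ℝ) * b ≤ n := by exact_mod_cast hab
  have hc : 0 < n / (a * b) := Nat.div_pos hab (by positivity)
  have hc2 : (n : ℝ) ≤ 2 * (n / (a * b) : ℕ) * (a * b) := by
    have h1 := Nat.lt_mul_div_succ n (show 0 < a * b by positivity)
    have h2 : n ≤ 2 * (n / (a * b)) * (a * b) := by
      refine h1.le.trans ?_
      rw [mul_comm (2 * _)]
      exact Nat.mul_le_mul_left _ (by omega)
    exact_mod_cast h2
  have hc0 : (0 : ℝ) < (n / (a * b) : ℕ) := by exact_mod_cast hc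
  set c := n / (a * b)
  have h1 : ((maxLoad S T a b c / n : ℕ) : ℝ) ≤
      (((nz S : ℝ) / a + (nz T : ℝ) / b + 2 * n) / c + 1 + n) / n := by
    refine Nat.cast_div_le.trans ?_
    unfold maxLoad
    push_cast
    gcongr
    refine Nat.cast_div_le.trans ?_
    push_cast
    gcongr <;> exact Nat.cast_div_le
  refine h1.trans ?_
  have h2 : ((nz S : ℝ) / a + (nz T : ℝ) / b + 2 * n) / c ≤
      ((nz S : ℝ) / a + (nz T : ℝ) / b + 2 * n) * (2 * (a * b) / n) := by
    rw [div_eq_mul_inv]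
    gcongr
    rw [inv_eq_one_div, div_le_div_iff₀ hc0 (by positivity)]
    linarith
  have h3 : (((nz S : ℝ) / a + (nz T : ℝ) / b + 2 * n) * (2 * (a * b) / n) + 1 + n) / n =
      2 * ((nz S : ℝ) * b / (n : ℝ) ^ 2 + (nz T : ℝ) * a / (n : ℝ) ^ 2) +
        4 * (a * b / n) + 1 / n + 1 := by
    field_simp
    ring
  have h4 : (a : ℝ) * b / n ≤ 1 := div_le_one_of_le₀ hab' (by positivity)
  have h5 : (1 : ℝ) / n ≤ 1 := div_le_one_of_le₀ hn' (by positivity)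
  calc _ ≤ (((nz S : ℝ) / a + (nz T : ℝ) / b + 2 * n) * (2 * (a * b) / n) + 1 + n) / n := by gcongr
    _ ≤ _ := by rw [h3]; linarith

theorem mainTheorem3 (w : ℕ) :
    ∃ β C : ℕ, ∀ (n a b : ℕ), IsSplitPair n a b →
      ∀ (R : Type u) [Semiring R] (F : Finset R), F.card ≤ 2 ^ (w * wordLength n) →
        ∃ SBMM : CliqueAlgorithm n (β * wordLength n) ((Fin n → R) × (Fin n → R)) (Fin n → R),
          ∀ S T : Matrix (Fin n) (Fin n) R, IsSparsityBalanced S T a b → Accommodates F S T →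
            ∃ t : ℕ,
              SBMM.CompletesIn (fun v => (S v, T v)) (fun v => (S * T) v) t ∧
              (t : ℝ) ≤ C * ((nz S : ℝ) * b / (n : ℝ) ^ 2 + (nz T : ℝ) * a / (n : ℝ) ^ 2
                + (n : ℝ) / (a * b) + 1) := by
  -- Four words pay for `(n + 1) ^ 4` and `w + 1` words for `F.card + 1`; the constant rounds add up
  -- to 12 + 2 · (6 + 2) + 2 = 30.
  refine ⟨w + 5, 30, fun n a b ⟨⟨ha, han'⟩, ⟨hb, hbn'⟩, han, hbn, hab⟩ R _ F hF => ?_⟩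
  have ha : 0 < a := ha
  have hb : 0 < b := hb
  have hn : 0 < n := ha.trans_le han'
  have ha' : (0 : ℝ) < a := by exact_mod_cast ha
  have hb' : (0 : ℝ) < b := by exact_mod_cast hb
  have hn' : (0 : ℝ) < n := by exact_mod_cast hn
  have hab : a * b ≤ n := by
    rw [one_le_div (by positivity)] at hab
    exact_mod_cast hab
  have hB : (n + 1) ^ 4 * (F.card + 1) ≤ 2 ^ ((w + 5) * wordLength n) := by
    have h1 : n + 1 ≤ 2 ^ wordLength n := Nat.lt_pow_succ_log_self one_lt_two n
    have h2 : F.card + 1 ≤ 2 ^ wordLength n * 2 ^ (w * wordLength n) := by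
      have : 1 ≤ 2 ^ (w * wordLength n) := Nat.one_le_two_pow
      nlinarith
    calc (n + 1) ^ 4 * (F.card + 1)
      _ ≤ (2 ^ wordLength n) ^ 4 * (2 ^ wordLength n * 2 ^ (w * wordLength n)) := by gcongr
      _ = 2 ^ ((w + 5) * wordLength n) := by ring
  obtain ⟨A, hA⟩ := exists_sbmm hn ha han hb hbn (Nat.div_pos hab (by positivity))
    (Nat.mul_div_le n (a * b)) F hB
  refine ⟨A, fun S T hbal hacc => ⟨_, hA S T hbal hacc, ?_⟩⟩
  have h1 := maxLoad_div_le S T hn ha hb hab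
  have h2 : ((n / a * (n / b) / n : ℕ) : ℝ) ≤ n / (a * b) := by
    refine Nat.cast_div_le.trans ?_
    rw [Nat.cast_mul, Nat.cast_div han ha'.ne', Nat.cast_div hbn hb'.ne']
    apply le_of_eq
    field_simp
  have h3 : 0 ≤ (nz S : ℝ) * b / (n : ℝ) ^ 2 := by positivity
  have h4 : 0 ≤ (nz T : ℝ) * a / (n : ℝ) ^ 2 := by positivity
  have h5 : 0 ≤ (n : ℝ) / (a * b) := by positivity
  push_cast at h1 h2 ⊢
  linarith
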